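/- Let $G = (N,\Sigma,R,S)$ be a context-free grammar with finitely many production rules $R \subseteq N \times (N \uplus \Sigma)^*$. Write $L(G) \subseteq \Sigma^*$ for the language generated by $G$ and $|G| = \sum_{(A \to \mathit{rhs}) \in R} (|\mathit{rhs}| + 1)$ for the size of $G$. Call a subset $T \subseteq L$ of a language $L \subseteq \Sigma^*$ a test set for $L$ if, for every alphabet $\Gamma$ and any two monoid morphisms $f, g : \Sigma^* \to \Gamma^*$, $f|_T = g|_T$ implies $f|_L = g|_L$. Theorem. For every context-free grammar $G$ there exists a test set $T \subseteq L(G)$ for $L(G)$ containing at most $2|G|^3$ words. -/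

import Mathlib

universe u v

/-- The size of a context-free grammar: the sum of `|rhs| + 1` over all of its rules. -/
def ContextFreeGrammar.size {α : Type*} (G : ContextFreeGrammar α) : ℕ :=
  ∑ r ∈ G.rules, (r.output.length + 1)

/-- `IsTestSet T L`: the set of words `T` is a subset of `L`, and any two morphisms `Σ* → Γ*`,
for any alphabet `Γ`, that agree on `T` also agree on `L`. -/
def IsTestSet {α : Type u} (T L : Set (List α)) : Prop :=
  T ⊆ L ∧ ∀ (Γ : Type v) (f g : FreeMonoid α →* FreeMonoid Γ),
    (∀ w ∈ T, f (FreeMonoid.ofList w) = g (FreeMonoid.ofList w)) →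
      ∀ w ∈ L, f (FreeMonoid.ofList w) = g (FreeMonoid.ofList w)

/-!
The free monoid over `Γ` embeds in a free group, so it is enough to consider two morphisms `φ` and
`ψ` into a free group `H`. The only property of `H` that matters is commutative transitivity
(`FreeGroup.commute_trans`).

*Reduction to a linear grammar.* Choose a word for every nonterminal that derives one. In a group,
the values of `x a d y`, `x c b y` and `x c d y` determine that of `x a b y` (`agree_exchange`). So
`φ` and `ψ` agree on `L(G)` as soon as they agree on the derivations in which each right-hand side
keeps at most one nonterminal and the others are replaced by their chosen words
(`ContextFreeGrammar.agree_of_agree_linearGraph`). These derivations are the paths in a graph with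
`m ≤ |G|` edges, each labelled by a left and a right word.

*Linear grammars.* For a path `p` with left word `u` and right word `v` put `X = ψ(u)⁻¹ φ(u)` and
`Y = ψ(v) φ(v)⁻¹`; then `φ` and `ψ` agree on `u v` if and only if `X = Y`. Order the paths by the
shortlex order and let `P` be the least path from the start to the end on which `φ` and `ψ` differ.
For every factorization `P = r t`, let `S r` be the set of all `X` of paths `r' t` with `r' < r`
parallel to `r`. These sets increase with `r`. The solutions `(a, b)` of the equations `a X = X b`,
`X ∈ S r`, form a decreasing chain, and by commutative transitivity there are only four possible
kinds of solution set: everything, the graph of a conjugation, a part of this graph over the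
centralizer of a nontrivial element, and `{(1, 1)}`. This is recorded by `level`. If the level is
the same before and after a segment `s` of `P`, then `s` is the least path between its end points:
exchanging `s` for a smaller one translates one of these sets into another of the same level, and
an equation that holds after the exchange holds for `P` too (`eq_of_level_eq`,
`PairGraph.isMinPath_of_level_eq`). The level increases at most three times, so `P` consists of
least paths separated by at most three edges (`PairGraph.mem_candidates`). There are at most
`1 + m + m ^ 2 + m ^ 3` such paths whatever `φ` and `ψ` are, and their words form a test set. This
number is at most `2 |G| ^ 3` if `2 ≤ |G|`, and a grammar of size at most `1` generates at most the
empty word.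
-/

/-! ### Commutative transitivity of free groups -/

/-- Compare the reduced words of `c * d` and `d * c`, where `c` is a letter other than the
first letter of `d` and its inverse: the first has no cancellation, so neither has the second. -/
theorem FreeGroup.subsingleton_of_central {X : Type*} {d : FreeGroup X} (hd : d ≠ 1)
    (hc : ∀ x : FreeGroup X, Commute x d) : Subsingleton X := by
  classical
  have hne : d.toWord ≠ [] := by simpa using hd
  obtain ⟨a, L, hL⟩ := List.exists_cons_of_ne_nil hne
  suffices h : ∀ z, z = a.1 from ⟨fun x y => (h x).trans (h y).symm⟩
  intro z
  by_contra hz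
  have h1 : (of z * d).toWord = (z, true) :: d.toWord := by
    have hred : IsReduced ((z, true) :: d.toWord) := by
      have := isReduced_toWord (x := d)
      rw [hL] at this ⊢
      exact isReduced_cons_cons.2 ⟨fun h => absurd h hz, this⟩
    rw [toWord_mul, toWord_of]
    exact hred.reduce_eq
  have h2 : (d * of z).toWord = d.toWord ++ [(z, true)] := by
    refine (?_ : List.Sublist _ _).eq_of_length ?_
    · simpa using toWord_mul_sublist d (of z)
    · rw [← (hc (of z)).eq, h1]
      simp
  rw [← (hc (of z)).eq, h1, hL] at h2
  simp only [List.cons_append, List.cons.injEq] at h2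
  exact hz (congrArg Prod.fst h2.1)

theorem FreeGroup.commute_of_subsingleton {X : Type*} [Subsingleton X] (x y : FreeGroup X) :
    Commute x y := by
  have key : ∀ (a : X) (y : FreeGroup X), Commute (of a) y := by
    intro a y
    induction y using FreeGroup.induction_on with
    | C1 => exact Commute.one_right _
    | of b => rw [Subsingleton.elim a b]
    | inv_of b h => exact h.inv_right
    | mul u v hu hv => exact hu.mul_right hv
  induction x using FreeGroup.induction_on with
  | C1 => exact Commute.one_left _
  | of b => exact key b y
  | inv_of b h => exact h.inv_left
  | mul u v hu hv => exact hu.mul_left hv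

/-- Free groups are commutative-transitive. The centralizer of `d` is free by the Nielsen–Schreier
theorem and has the nontrivial central element `d`, so it has rank at most one. -/
theorem FreeGroup.commute_trans {X : Type*} {c d e : FreeGroup X} (hd : d ≠ 1)
    (hc : Commute c d) (he : Commute e d) : Commute c e := by
  let H : Subgroup (FreeGroup X) := Subgroup.centralizer {d}
  have mem : ∀ x, x ∈ H ↔ Commute x d := fun x => by
    simp [H, Subgroup.mem_centralizer_iff, Commute, SemiconjBy, eq_comm]
  let φ : H ≃* FreeGroup (IsFreeGroup.Generators H) := IsFreeGroup.toFreeGroup H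
  let d' : H := ⟨d, (mem d).2 (Commute.refl d)⟩
  have hd' : φ d' ≠ 1 := by
    rw [Ne, map_eq_one_iff φ φ.injective]
    exact fun h => hd (congrArg Subtype.val h)
  have hcent : ∀ x, Commute x (φ d') := fun x => by
    obtain ⟨x, rfl⟩ := φ.surjective x
    exact Commute.map (show Commute x d' from Subtype.ext ((mem x.1).1 x.2).eq) φ
  have := FreeGroup.subsingleton_of_central hd' hcent
  have h : φ (⟨c, (mem c).2 hc⟩ * ⟨e, (mem e).2 he⟩) =
      φ (⟨e, (mem e).2 he⟩ * ⟨c, (mem c).2 hc⟩) := by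
    rw [MulEquiv.map_mul, MulEquiv.map_mul]
    exact FreeGroup.commute_of_subsingleton _ _
  exact congrArg Subtype.val (φ.injective h)

/-- A free monoid embeds in the free group on the same letters: positive words are reduced. -/
theorem FreeMonoid.lift_of_injective (X : Type*) :
    Function.Injective (FreeMonoid.lift (FreeGroup.of : X → FreeGroup X)) := by
  classical
  have key : ∀ w : FreeMonoid X,
      FreeMonoid.lift (FreeGroup.of : X → FreeGroup X) w =
        FreeGroup.mk (w.toList.map fun x => (x, true)) := by
    intro w
    induction w using FreeMonoid.inductionOn' with
    | one => rfl
    | of_mul x xs ih =>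
      rw [map_mul, ih, FreeMonoid.lift_eval_of, FreeGroup.of, FreeGroup.mul_mk]
      simp
  have red : ∀ w : List X, FreeGroup.IsReduced (w.map fun x => (x, true)) := by
    intro w
    rw [FreeGroup.IsReduced, List.isChain_map]
    exact (List.pairwise_of_forall (by simp)).isChain
  intro v w h
  rw [key, key] at h
  have h' := congrArg FreeGroup.toWord h
  rw [FreeGroup.toWord_mk, FreeGroup.toWord_mk, (red _).reduce_eq, (red _).reduce_eq] at h'
  exact List.map_injective_iff.2 (fun x y hxy => congrArg Prod.fst hxy) h'

/-! ### Levels of sets in a commutative-transitive group -/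

/-- The quotients `x * y⁻¹` of elements of `S` commute with each other. -/
def QuotientsCommute {H : Type*} [Group H] (S : Set H) : Prop :=
  ∀ x ∈ S, ∀ y ∈ S, ∀ z ∈ S, ∀ w ∈ S, Commute (x * y⁻¹) (z * w⁻¹)

open Classical in
/-- The level of a set `S` in a group. In a commutative-transitive group it measures the solution
set of the system of equations `a * x = x * b`, `x ∈ S`, in the unknowns `a` and `b`: levels
`0`, `1`, `2`, `3` mean that `(a, b)` is arbitrary, that `a` is arbitrary and determines `b`, that
`a` ranges over the centralizer of a nontrivial element, and that `a = b = 1`. -/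
noncomputable def level {H : Type*} [Group H] (S : Set H) : ℕ :=
  if S = ∅ then 0 else if S.Subsingleton then 1 else if QuotientsCommute S then 2 else 3

theorem level_le_three {H : Type*} [Group H] (S : Set H) : level S ≤ 3 := by
  unfold level
  split_ifs <;> omega

theorem level_mono {H : Type*} [Group H] {S T : Set H} (h : S ⊆ T) : level S ≤ level T := by
  have h0 : T = ∅ → S = ∅ := fun hT => Set.subset_eq_empty h hT
  have h1 : T.Subsingleton → S.Subsingleton := fun hT => hT.anti h
  have h2 : QuotientsCommute T → QuotientsCommute S := fun hT x hx y hy z hz w hw =>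
    hT x (h hx) y (h hy) z (h hz) w (h hw)
  have h3 : S = ∅ → S.Subsingleton := fun hS => hS ▸ Set.subsingleton_empty
  unfold level
  split_ifs <;> first | omega | tauto

/-- Read a pair `(x, y)` as the equation `a * x = y * b`, and `x ∈ H` as the pair `(x, x)`. The
sets `T` and `h * S * k ⊆ T` have the same level, so they impose the same equations. The pair
`(h * X * k, h' * Y * k')` belongs to `T`, so its equation follows from those of `h * S * k`.
Undoing the translation, the equation of `(X, Y)` follows from those of `S`, which hold for
`a = b = 1`. -/
theorem eq_of_level_eq {H : Type*} [Group H]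
    (htrans : ∀ c d e : H, d ≠ 1 → Commute c d → Commute e d → Commute c e)
    {S T : Set H} (hST : S ⊆ T) (hlev : level S = level T) {h k h' k' X Y : H}
    (hS : ∀ x ∈ S, h * x * k = h' * x * k') (hT : ∀ x ∈ S, h * x * k ∈ T)
    (hX : h * X * k ∈ T) (hXY : h * X * k = h' * Y * k') : X = Y := by
  -- In terms of `c` and `d` the hypotheses read `c * x = x * d` for `x ∈ S` and `c * X = Y * d`.
  obtain ⟨c, hc⟩ : ∃ c, c = h'⁻¹ * h := ⟨_, rfl⟩
  obtain ⟨d, hd⟩ : ∃ d, d = k' * k⁻¹ := ⟨_, rfl⟩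
  have aux : ∀ x y, h * x * k = h' * y * k' → c * x = y * d := fun x y e => by
    calc c * x = h'⁻¹ * (h * x * k) * k⁻¹ := by rw [hc]; group
      _ = y * d := by rw [e, hd]; group
  have hcS : ∀ x ∈ S, c * x = x * d := fun x hx => aux x x (hS x hx)
  have hcXY : c * X = Y * d := aux X Y hXY
  have hcomm : ∀ x ∈ S, ∀ y ∈ S, Commute c (x * y⁻¹) := fun x hx y hy => by
    have hd : d = y⁻¹ * c * y := by rw [mul_assoc, hcS y hy]; group
    rw [Commute, SemiconjBy, ← mul_assoc, hcS x hx, hd]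
    group
  have hTne : T ≠ ∅ := fun h0 => by rw [h0] at hX; exact hX
  have hSne : S ≠ ∅ := fun h0 => by
    have : level T = 0 := by rw [← hlev, level, if_pos h0]
    unfold level at this
    split_ifs at this
    all_goals first | omega | contradiction
  obtain ⟨x₀, hx₀⟩ := Set.nonempty_iff_ne_empty.2 hSne
  by_cases hsub : S.Subsingleton
  · have hTsub : T.Subsingleton := by
      by_contra hn
      simp only [level, hSne, hTne, hsub, hn, if_true, if_false] at hlev
      split_ifs at hlev
      all_goals omega
    have e : h * X * k = h * x₀ * k := hTsub hX (hT x₀ hx₀)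
    have e1 : X = x₀ := by simpa using e
    have e2 : h' * Y * k' = h' * x₀ * k' := by rw [← hXY, e, hS x₀ hx₀]
    have e3 : Y = x₀ := by simpa using e2
    rw [e1, e3]
  have hTsub : ¬ T.Subsingleton := fun hn => hsub (hn.anti hST)
  suffices hcX : c * X = X * d by
    rw [hcX] at hcXY
    exact mul_right_cancel hcXY
  by_cases hcom : QuotientsCommute S
  · have hTcom : QuotientsCommute T := by
      by_contra hn
      simp only [level, hSne, hTne, hsub, hTsub, hcom, hn, if_true, if_false] at hlev
      omega
    obtain ⟨y, hy, z, hz, hyz⟩ : ∃ y ∈ S, ∃ z ∈ S, y ≠ z := Set.not_subsingleton_iff.1 hsub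
    have hne : y * z⁻¹ ≠ 1 := fun h1 => hyz (mul_inv_eq_one.1 h1)
    have h1 : Commute (X * x₀⁻¹) (y * z⁻¹) := by
      have := hTcom _ hX _ (hT x₀ hx₀) _ (hT y hy) _ (hT z hz)
      have e : ∀ a b : H, h * a * k * (h * b * k)⁻¹ = h * (a * b⁻¹) * h⁻¹ := fun a b => by group
      rw [e, e] at this
      simpa using this
    have h2 := htrans _ _ _ hne (hcomm y hy z hz) h1
    have hd : d = x₀⁻¹ * c * x₀ := by rw [mul_assoc, hcS x₀ hx₀]; group
    calc c * X = c * (X * x₀⁻¹) * x₀ := by group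
      _ = X * d := by rw [h2.eq, hd]; group
  · -- At level `3` the element `c` commutes with two elements that do not commute.
    have hc1 : c = 1 := by
      by_contra hne
      refine hcom fun x hx y hy z hz w hw => ?_
      exact htrans _ _ _ hne (hcomm x hx y hy).symm (hcomm z hz w hw).symm
    have hd1 : d = 1 := by simpa [hc1] using hcS x₀ hx₀
    rw [hc1, hd1, one_mul, mul_one]

/-! ### Shortlex-minimal paths -/

theorem List.Shortlex.append_append {ι : Type*} {r : ι → ι → Prop} {s t : List ι}
    (h : List.Shortlex r s t) (u : List ι) : List.Shortlex r (s ++ u) (t ++ u) := by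
  rcases List.shortlex_def.1 h with h | ⟨hl, h⟩
  · exact List.Shortlex.of_length_lt (by simpa using h)
  · refine List.Shortlex.of_lex (by simpa using hl) ?_
    clear * - hl h
    induction h with
    | nil => simp at hl
    | cons _ ih => exact List.Lex.cons (ih (by simpa using hl))
    | rel h => exact List.Lex.rel h

/-- The shortlex order on the lists over `ι` with respect to some well-order of `ι`. -/
def PathLT {ι : Type*} : List ι → List ι → Prop := List.Shortlex WellOrderingRel

theorem pathLT_wellFounded {ι : Type*} : WellFounded (PathLT (ι := ι)) :=
  List.Shortlex.wf IsWellFounded.wf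

theorem pathLT_trans {ι : Type*} {a b c : List ι} (hab : PathLT a b) (hbc : PathLT b c) :
    PathLT a c := by
  have htrans : ∀ {a b c : List ι}, List.Lex WellOrderingRel a b → List.Lex WellOrderingRel b c →
      List.Lex WellOrderingRel a c := by
    intro a b c hab
    induction hab generalizing c with
    | nil => rintro (_ | _ | _) <;> exact List.Lex.nil
    | cons _ ih =>
      intro hbc
      cases hbc with
      | cons h => exact List.Lex.cons (ih h)
      | rel h => exact List.Lex.rel h
    | rel h =>
      intro hbc
      cases hbc with
      | cons _ => exact List.Lex.rel h
      | rel h' => exact List.Lex.rel (_root_.trans h h')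
  rcases List.shortlex_def.1 hab with h | ⟨h, h1⟩ <;>
    rcases List.shortlex_def.1 hbc with h' | ⟨h', h2⟩
  · exact List.Shortlex.of_length_lt (h.trans h')
  · exact List.Shortlex.of_length_lt (h.trans_eq h')
  · exact List.Shortlex.of_length_lt (h.trans_lt h')
  · exact List.Shortlex.of_lex (h.trans h') (htrans h1 h2)

/-- A directed multigraph on `V` with edges `ι`, each labelled by a pair of elements of `M`: the
right-hand sides `left · B · right` of the rules of a linear grammar. -/
structure PairGraph (V ι M : Type*) where
  /-- the source of an edge -/
  src : ι → V
  /-- the target of an edge -/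
  tgt : ι → V
  /-- the label that an edge adds on the left -/
  left : ι → M
  /-- the label that an edge adds on the right -/
  right : ι → M

namespace PairGraph

section Paths

variable {V ι M : Type*} (G : PairGraph V ι M)

/-- The list of edges `p` is a path from `q` to `q'`. -/
def IsPath (q : V) : List ι → V → Prop
  | [], q' => q = q'
  | e :: p, q' => G.src e = q ∧ IsPath (G.tgt e) p q'

theorem isPath_append {q q' : V} {p s : List ι} :
    G.IsPath q (p ++ s) q' ↔ ∃ x, G.IsPath q p x ∧ G.IsPath x s q' := by
  induction p generalizing q with
  | nil => simp [IsPath]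
  | cons e p ih => simp [IsPath, ih, and_assoc]

theorem isPath_singleton {e : ι} {q' : V} : G.IsPath (G.src e) [e] q' ↔ G.tgt e = q' := by
  simp [IsPath]

theorem IsPath.append {G : PairGraph V ι M} {q x q' : V} {p s : List ι} (hp : G.IsPath q p x)
    (hs : G.IsPath x s q') : G.IsPath q (p ++ s) q' :=
  G.isPath_append.2 ⟨x, hp, hs⟩

/-- The path `p` from `q` to `q'` is minimal among all such paths. -/
def IsMinPath (q : V) (p : List ι) (q' : V) : Prop :=
  G.IsPath q p q' ∧ ∀ s, G.IsPath q s q' → ¬ PathLT s p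

open Classical in
/-- The minimal path from `q` to `q'`, and `[]` if there is no path. -/
noncomputable def minPath (q q' : V) : List ι :=
  if h : ∃ p, G.IsMinPath q p q' then h.choose else []

theorem IsMinPath.eq_minPath {G : PairGraph V ι M} {q q' : V} {p : List ι}
    (h : G.IsMinPath q p q') : p = G.minPath q q' := by
  have hex : ∃ p, G.IsMinPath q p q' := ⟨p, h⟩
  rw [minPath, dif_pos hex]
  exact (List.Shortlex.trichotomous (r := WellOrderingRel)).trichotomous _ _
    (hex.choose_spec.2 p h.1) (h.2 _ hex.choose_spec.1)

open Classical in
/-- The paths from `q` to `F` that consist of minimal paths separated by at most `k` edges. -/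
noncomputable def candidates [Fintype ι] (F : V) : ℕ → V → Finset (List ι)
  | 0, q => {G.minPath q F}
  | k + 1, q => insert (G.minPath q F) (Finset.univ.biUnion fun e =>
      (candidates F k (G.tgt e)).image fun p => G.minPath q (G.src e) ++ e :: p)

theorem card_candidates_le [Fintype ι] (F : V) (k : ℕ) (q : V) :
    (G.candidates F k q).card ≤ ∑ i ∈ Finset.range (k + 1), Fintype.card ι ^ i := by
  classical
  induction k generalizing q with
  | zero => simp [candidates]
  | succ k ih =>
    rw [candidates, Finset.sum_range_succ', pow_zero]
    refine (Finset.card_insert_le _ _).trans (Nat.add_le_add_right ?_ 1)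
    refine Finset.card_biUnion_le.trans ?_
    refine (Finset.sum_le_card_nsmul _ _ _ fun e _ => Finset.card_image_le.trans (ih _)).trans ?_
    simp [Finset.mul_sum, pow_succ']

theorem minPath_mem_candidates [Fintype ι] (F : V) (k : ℕ) (q : V) :
    G.minPath q F ∈ G.candidates F k q := by
  cases k <;> simp [candidates]

end Paths

section Words

variable {V ι M H : Type*} [Monoid M] [Group H] (G : PairGraph V ι M) (φ ψ : M →* H)

/-- The product of the left labels along a path. -/
def leftProd (p : List ι) : M := (p.map G.left).prod

/-- The product of the right labels along a path, the last edge first. -/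
def rightProd (p : List ι) : M := (p.reverse.map G.right).prod

/-- The word that a path produces. -/
def word (p : List ι) : M := G.leftProd p * G.rightProd p

theorem leftProd_append (p s : List ι) : G.leftProd (p ++ s) = G.leftProd p * G.leftProd s := by
  simp [leftProd]

theorem rightProd_append (p s : List ι) :
    G.rightProd (p ++ s) = G.rightProd s * G.rightProd p := by
  simp [rightProd]

theorem word_append (p s : List ι) :
    G.word (p ++ s) = G.leftProd p * G.word s * G.rightProd p := by
  simp only [word, leftProd_append, rightProd_append, mul_assoc]

/-- The discrepancy of `φ` and `ψ` on the left labels of a path. -/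
def leftDisc (p : List ι) : H := (ψ (G.leftProd p))⁻¹ * φ (G.leftProd p)

/-- The discrepancy of `φ` and `ψ` on the right labels of a path. -/
def rightDisc (p : List ι) : H := ψ (G.rightProd p) * (φ (G.rightProd p))⁻¹

theorem map_word_eq_iff (p : List ι) :
    φ (G.word p) = ψ (G.word p) ↔ G.leftDisc φ ψ p = G.rightDisc φ ψ p := by
  rw [word, leftDisc, rightDisc, map_mul, map_mul, eq_mul_inv_iff_mul_eq, mul_assoc,
    inv_mul_eq_iff_eq_mul]

theorem leftDisc_append (p s s' : List ι) :
    G.leftDisc φ ψ (p ++ s') = ((ψ (G.leftProd s'))⁻¹ * ψ (G.leftProd s)) *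
      G.leftDisc φ ψ (p ++ s) * ((φ (G.leftProd s))⁻¹ * φ (G.leftProd s')) := by
  simp only [leftDisc, leftProd_append, map_mul]
  group

theorem rightDisc_append (p s s' : List ι) :
    G.rightDisc φ ψ (p ++ s') = (ψ (G.rightProd s') * (ψ (G.rightProd s))⁻¹) *
      G.rightDisc φ ψ (p ++ s) * (φ (G.rightProd s) * (φ (G.rightProd s'))⁻¹) := by
  simp only [rightDisc, rightProd_append, map_mul]
  group

/-- The left discrepancies of the paths `r' ++ t`, where `r'` is a path from `S` to `q` that is
smaller than `r`. -/
def smallerDiscs (S : V) (r : List ι) (q : V) (t : List ι) : Set H :=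
  {x | ∃ r', PathLT r' r ∧ G.IsPath S r' q ∧ x = G.leftDisc φ ψ (r' ++ t)}

theorem smallerDiscs_subset {S q q' : V} {r s t : List ι} (hs : G.IsPath q s q') :
    G.smallerDiscs φ ψ S r q (s ++ t) ⊆ G.smallerDiscs φ ψ S (r ++ s) q' t := by
  rintro _ ⟨r', hlt, hr', rfl⟩
  exact ⟨r' ++ s, hlt.append_append s, hr'.append hs, by rw [List.append_assoc]⟩

/-- In a minimal path on which `φ` and `ψ` differ, a segment along which the level stays the same
is a minimal path. -/
theorem isMinPath_of_level_eq
    (htrans : ∀ c d e : H, d ≠ 1 → Commute c d → Commute e d → Commute c e)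
    {S q q' F : V} {r s t : List ι} (hr : G.IsPath S r q) (hs : G.IsPath q s q')
    (ht : G.IsPath q' t F) (hne : φ (G.word (r ++ (s ++ t))) ≠ ψ (G.word (r ++ (s ++ t))))
    (hmin : ∀ p, PathLT p (r ++ (s ++ t)) → G.IsPath S p F → φ (G.word p) = ψ (G.word p))
    (hlev : level (G.smallerDiscs φ ψ S r q (s ++ t)) =
      level (G.smallerDiscs φ ψ S (r ++ s) q' t)) : G.IsMinPath q s q' := by
  refine ⟨hs, fun s' hs' hlt => hne ((G.map_word_eq_iff φ ψ _).2 ?_)⟩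
  have agree : ∀ p, PathLT p (r ++ (s ++ t)) → G.IsPath S p F →
      G.leftDisc φ ψ p = G.rightDisc φ ψ p := fun p h1 h2 =>
    (G.map_word_eq_iff φ ψ p).1 (hmin p h1 h2)
  have hlt' : PathLT (r ++ (s' ++ t)) (r ++ (s ++ t)) := (hlt.append_append t).append_left r
  refine eq_of_level_eq htrans (G.smallerDiscs_subset φ ψ hs) hlev
    (h := (ψ (G.leftProd (s' ++ t)))⁻¹ * ψ (G.leftProd (s ++ t)))
    (k := (φ (G.leftProd (s ++ t)))⁻¹ * φ (G.leftProd (s' ++ t)))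
    (h' := ψ (G.rightProd (s' ++ t)) * (ψ (G.rightProd (s ++ t)))⁻¹)
    (k' := φ (G.rightProd (s ++ t)) * (φ (G.rightProd (s' ++ t)))⁻¹) ?_ ?_ ?_ ?_
  · rintro _ ⟨r', hr'lt, hr', rfl⟩
    rw [← leftDisc_append]
    rw [agree _ (hr'lt.append_append _) (hr'.append (hs.append ht)), ← rightDisc_append]
    exact agree _ (pathLT_trans (hr'lt.append_append _) hlt') (hr'.append (hs'.append ht))
  · rintro _ ⟨r', hr'lt, hr', rfl⟩
    rw [← leftDisc_append]
    refine ⟨r' ++ s', pathLT_trans (hr'lt.append_append _) (hlt.append_left r), hr'.append hs', ?_⟩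
    rw [List.append_assoc]
  · rw [← leftDisc_append]
    exact ⟨r ++ s', hlt.append_left r, hr.append hs', by rw [List.append_assoc]⟩
  · rw [← leftDisc_append, ← rightDisc_append]
    exact agree _ hlt' (hr.append (hs'.append ht))

/-- A minimal path on which `φ` and `ψ` differ consists of minimal paths separated by edges at
which the level increases. In the induction on `t`, the segment `s` is the part already read since
the last increase, and `k` bounds the number of increases that are still possible. -/
theorem mem_candidates [Fintype ι]
    (htrans : ∀ c d e : H, d ≠ 1 → Commute c d → Commute e d → Commute c e)
    {S F : V} {P : List ι} (hne : φ (G.word P) ≠ ψ (G.word P))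
    (hmin : ∀ p, PathLT p P → G.IsPath S p F → φ (G.word p) = ψ (G.word p))
    {q q' : V} {r s t : List ι} {k : ℕ} (hP : P = r ++ (s ++ t)) (hr : G.IsPath S r q)
    (hs : G.IsPath q s q') (ht : G.IsPath q' t F)
    (hlev : level (G.smallerDiscs φ ψ S r q (s ++ t)) =
      level (G.smallerDiscs φ ψ S (r ++ s) q' t))
    (hk : 3 ≤ k + level (G.smallerDiscs φ ψ S r q (s ++ t))) :
    s ++ t ∈ G.candidates F k q := by
  classical
  have hsmin : G.IsMinPath q s q' :=
    G.isMinPath_of_level_eq φ ψ htrans hr hs ht (hP ▸ hne) (hP ▸ hmin) hlev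
  induction t generalizing q q' r s k with
  | nil =>
    obtain rfl : q' = F := ht
    rw [List.append_nil, hsmin.eq_minPath]
    exact G.minPath_mem_candidates q' k q
  | cons e t ih =>
    obtain ⟨rfl, ht⟩ := ht
    have he := G.isPath_singleton.2 (rfl : G.tgt e = G.tgt e)
    have hsplit : s ++ e :: t = s ++ [e] ++ t := by simp
    have hsub := G.smallerDiscs_subset φ ψ (S := S) (r := r) (t := t) (hs.append he)
    by_cases hlev' : level (G.smallerDiscs φ ψ S r q (s ++ e :: t)) =
        level (G.smallerDiscs φ ψ S (r ++ (s ++ [e])) (G.tgt e) t)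
    · rw [hsplit] at hlev' hk hP ⊢
      exact ih hP hr (hs.append he) ht hlev' hk
        (G.isMinPath_of_level_eq φ ψ htrans hr (hs.append he) ht (hP ▸ hne) (hP ▸ hmin) hlev')
    · have hlt : level (G.smallerDiscs φ ψ S r q (s ++ e :: t)) <
          level (G.smallerDiscs φ ψ S (r ++ (s ++ [e])) (G.tgt e) t) :=
        lt_of_le_of_ne (by rw [hsplit]; exact level_mono hsub) hlev'
      have h3 := level_le_three (G.smallerDiscs φ ψ S (r ++ (s ++ [e])) (G.tgt e) t)
      obtain ⟨k, rfl⟩ : ∃ j, k = j + 1 := ⟨k - 1, by omega⟩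
      have hrec : [] ++ t ∈ G.candidates F k (G.tgt e) := by
        have hP' : P = (r ++ (s ++ [e])) ++ ([] ++ t) := by simp [hP]
        have hr' := hr.append (hs.append he)
        have hnil : G.IsPath (G.tgt e) [] (G.tgt e) := rfl
        have hlev'' : level (G.smallerDiscs φ ψ S (r ++ (s ++ [e])) (G.tgt e) ([] ++ t)) =
            level (G.smallerDiscs φ ψ S (r ++ (s ++ [e]) ++ []) (G.tgt e) t) := by simp
        exact ih hP' hr' hnil ht hlev'' (by rw [List.nil_append]; omega)
          (G.isMinPath_of_level_eq φ ψ htrans hr' hnil ht (hP' ▸ hne) (hP' ▸ hmin) hlev'')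
      rw [candidates, hsmin.eq_minPath]
      refine Finset.mem_insert_of_mem (Finset.mem_biUnion.2 ⟨e, Finset.mem_univ e, ?_⟩)
      exact Finset.mem_image_of_mem (fun p => G.minPath q (G.src e) ++ e :: p) hrec

end Words

/-- The words of the paths from `S` to `F` in a finite graph with `m` edges have a test set with at
most `1 + m + m ^ 2 + m ^ 3` elements for morphisms into commutative-transitive groups. -/
theorem exists_testSet {V ι M : Type*} [Monoid M] [Fintype ι] (G : PairGraph V ι M) (S F : V) :
    ∃ T : Finset M, T.card ≤ ∑ i ∈ Finset.range 4, Fintype.card ι ^ i ∧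
      (∀ w ∈ T, ∃ p, G.IsPath S p F ∧ G.word p = w) ∧
      ∀ (H : Type v) [Group H],
        (∀ c d e : H, d ≠ 1 → Commute c d → Commute e d → Commute c e) →
        ∀ φ ψ : M →* H, (∀ w ∈ T, φ w = ψ w) →
          ∀ p, G.IsPath S p F → φ (G.word p) = ψ (G.word p) := by
  classical
  refine ⟨((G.candidates F 3 S).filter fun p => G.IsPath S p F).image G.word, ?_, ?_, ?_⟩
  · exact Finset.card_image_le.trans
      ((Finset.card_filter_le _ _).trans (G.card_candidates_le F 3 S))
  · intro w hw
    obtain ⟨p, hp, rfl⟩ := Finset.mem_image.1 hw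
    exact ⟨p, (Finset.mem_filter.1 hp).2, rfl⟩
  · intro H _ htrans φ ψ hT p
    induction p using pathLT_wellFounded.induction with
    | _ P ih =>
    intro hP
    by_contra hne
    have hmem : P ∈ G.candidates F 3 S :=
      G.mem_candidates (r := []) (s := []) (t := P) φ ψ htrans hne ih rfl
        rfl rfl hP rfl (by omega)
    exact hne (hT _ (Finset.mem_image_of_mem _ (Finset.mem_filter.2 ⟨hmem, hP⟩)))

end PairGraph

/-! ### Reduction to a linear grammar -/

namespace ContextFreeGrammar

variable {α : Type u} (G : ContextFreeGrammar α)

/-- `G.Yields s w`: the sentential form `s` derives the terminal word `w`. The derivation trees for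
the symbols of `s` are listed from left to right. -/
inductive Yields : List (Symbol α G.NT) → List α → Prop
  /-- The empty form derives the empty word. -/
  | nil : Yields [] []
  /-- A terminal symbol derives itself. -/
  | terminal (a : α) {s : List (Symbol α G.NT)} {w : List α} (h : Yields s w) :
      Yields (Symbol.terminal a :: s) (a :: w)
  /-- A nonterminal symbol is rewritten by some rule. -/
  | nonterminal {r : ContextFreeRule α G.NT} (hr : r ∈ G.rules) {s : List (Symbol α G.NT)}
      {w w' : List α} (h : Yields r.output w) (h' : Yields s w') :
      Yields (Symbol.nonterminal r.input :: s) (w ++ w')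

variable {G}

theorem Yields.append {s t : List (Symbol α G.NT)} {v w : List α} (hs : G.Yields s v)
    (ht : G.Yields t w) : G.Yields (s ++ t) (v ++ w) := by
  induction hs with
  | nil => exact ht
  | terminal a _ ih => exact ih.terminal a
  | nonterminal hr h _ _ ih =>
    rw [List.append_assoc]
    exact .nonterminal hr h ih

theorem Yields.exists_of_append {s t : List (Symbol α G.NT)} {w : List α}
    (h : G.Yields (s ++ t) w) : ∃ w₁ w₂, G.Yields s w₁ ∧ G.Yields t w₂ ∧ w = w₁ ++ w₂ := by
  induction s generalizing w with
  | nil => exact ⟨[], w, .nil, h, rfl⟩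
  | cons x s ih =>
    cases h with
    | terminal a h =>
      obtain ⟨w₁, w₂, h₁, h₂, rfl⟩ := ih h
      exact ⟨a :: w₁, w₂, h₁.terminal a, h₂, rfl⟩
    | nonterminal hr h h' =>
      obtain ⟨w₁, w₂, h₁, h₂, rfl⟩ := ih h'
      exact ⟨_, w₂, .nonterminal hr h h₁, h₂, (List.append_assoc _ _ _).symm⟩

theorem Yields.of_rule {r : ContextFreeRule α G.NT} (hr : r ∈ G.rules) {w : List α}
    (h : G.Yields r.output w) : G.Yields [Symbol.nonterminal r.input] w := by
  simpa using Yields.nonterminal hr h .nil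

theorem Yields.exists_rule {A : G.NT} {w : List α} (h : G.Yields [Symbol.nonterminal A] w) :
    ∃ r ∈ G.rules, r.input = A ∧ G.Yields r.output w := by
  generalize hs : [Symbol.nonterminal A] = s at h
  cases h with
  | nil => cases hs
  | terminal => cases hs
  | @nonterminal r hr s w w' h h' =>
    obtain ⟨hA, rfl⟩ := List.cons.inj hs
    cases h'
    exact ⟨r, hr, (Symbol.nonterminal.inj hA).symm, by rwa [List.append_nil]⟩

theorem yields_iff_derives {s : List (Symbol α G.NT)} {w : List α} :
    G.Yields s w ↔ G.Derives s (w.map Symbol.terminal) := by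
  constructor
  · intro h
    induction h with
    | nil => exact Derives.refl _
    | terminal a _ ih => exact ih.append_left [Symbol.terminal a]
    | @nonterminal r hr s w w' _ _ ih ih' =>
      have h1 : G.Produces (Symbol.nonterminal r.input :: s) (r.output ++ s) :=
        ⟨r, hr, ContextFreeRule.Rewrites.head s⟩
      rw [List.map_append]
      exact h1.trans_derives ((ih.append_right s).trans (ih'.append_left _))
  · intro h
    induction h using Relation.ReflTransGen.head_induction_on with
    | refl =>
      induction w with
      | nil => exact .nil
      | cons a w ih => exact ih.terminal a
    | head hp _ ih =>
      obtain ⟨r, hr, hrw⟩ := hp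
      obtain ⟨p, q, rfl, rfl⟩ := hrw.exists_parts
      obtain ⟨_, w₃, h, h₃, rfl⟩ := ih.exists_of_append
      obtain ⟨w₁, w₂, h₁, h₂, rfl⟩ := h.exists_of_append
      exact (h₁.append (.of_rule hr h₂)).append h₃

theorem mem_language_iff_yields {w : List α} :
    w ∈ G.language ↔ G.Yields [Symbol.nonterminal G.initial] w := by
  rw [mem_language_iff, yields_iff_derives]

variable (G)

open Classical in
/-- A chosen terminal word derived from the nonterminal `A`, and `[]` if there is none. -/
noncomputable def fillNonterminal (A : G.NT) : List α :=
  if h : ∃ w, G.Yields [Symbol.nonterminal A] w then h.choose else []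

/-- A sentential form with every nonterminal replaced by its chosen word. -/
noncomputable def fill : List (Symbol α G.NT) → List α
  | [] => []
  | Symbol.terminal a :: s => a :: fill s
  | Symbol.nonterminal A :: s => G.fillNonterminal A ++ fill s

variable {G}

theorem fill_append (s t : List (Symbol α G.NT)) : G.fill (s ++ t) = G.fill s ++ G.fill t := by
  induction s with
  | nil => rfl
  | cons x s ih => cases x <;> simp [fill, ih]

theorem Yields.fill {s : List (Symbol α G.NT)} {w : List α} (h : G.Yields s w) :
    G.Yields s (G.fill s) := by
  induction h with
  | nil => exact .nil
  | terminal a _ ih => exact ih.terminal a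
  | @nonterminal r hr s w w' h _ _ ih =>
    have hex : ∃ w, G.Yields [Symbol.nonterminal r.input] w := ⟨w, .of_rule hr h⟩
    have : G.Yields [Symbol.nonterminal r.input] (G.fillNonterminal r.input) := by
      rw [fillNonterminal, dif_pos hex]
      exact hex.choose_spec
    exact this.append ih

variable (G)

open Classical in
/-- The edges of `G.linearGraph`: a rule whose right-hand side derives some word, together with a
position in its right-hand side or the end position. -/
noncomputable def linearEdges : Finset (Σ _ : ContextFreeRule α G.NT, ℕ) :=
  (G.rules.sigma fun r => Finset.range (r.output.length + 1)).filter
    fun e => ∃ w, G.Yields e.1.output w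

theorem mem_linearEdges {r : ContextFreeRule α G.NT} {i : ℕ} :
    (⟨r, i⟩ : Σ _ : ContextFreeRule α G.NT, ℕ) ∈ G.linearEdges ↔
      (r ∈ G.rules ∧ i ≤ r.output.length) ∧ ∃ w, G.Yields r.output w := by
  simp [linearEdges]

theorem card_linearEdges_le : Fintype.card G.linearEdges ≤ G.size := by
  classical
  rw [Fintype.card_coe, linearEdges]
  refine (Finset.card_filter_le _ _).trans ?_
  rw [Finset.card_sigma]
  simp [ContextFreeGrammar.size]

/-- The linear grammar obtained from `G` by keeping at most one nonterminal in each right-hand side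
and replacing the others by their chosen words. The vertex `none` ends a derivation; a position
that does not hold a nonterminal stands for the rule in which all nonterminals are replaced. -/
noncomputable def linearGraph : PairGraph (Option G.NT) G.linearEdges (FreeMonoid α) where
  src e := some e.1.1.input
  tgt e := match e.1.1.output[e.1.2]? with
    | some (Symbol.nonterminal B) => some B
    | _ => none
  left e := match e.1.1.output[e.1.2]? with
    | some (Symbol.nonterminal _) => FreeMonoid.ofList (G.fill (e.1.1.output.take e.1.2))
    | _ => FreeMonoid.ofList (G.fill e.1.1.output)
  right e := match e.1.1.output[e.1.2]? with
    | some (Symbol.nonterminal _) => FreeMonoid.ofList (G.fill (e.1.1.output.drop (e.1.2 + 1)))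
    | _ => 1

/-- The words that a vertex of `G.linearGraph` derives in `G`. -/
def VertexYields : Option G.NT → List α → Prop
  | none, w => w = []
  | some A, w => G.Yields [Symbol.nonterminal A] w

variable {G}

theorem linearGraph_of_nonterminal {e : G.linearEdges} {B : G.NT}
    (h : e.1.1.output[e.1.2]? = some (Symbol.nonterminal B)) :
    G.linearGraph.tgt e = some B ∧
      G.linearGraph.left e = FreeMonoid.ofList (G.fill (e.1.1.output.take e.1.2)) ∧
      G.linearGraph.right e = FreeMonoid.ofList (G.fill (e.1.1.output.drop (e.1.2 + 1))) := by
  simp [linearGraph, h]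

theorem linearGraph_of_not_nonterminal {e : G.linearEdges}
    (h : ∀ B, e.1.1.output[e.1.2]? ≠ some (Symbol.nonterminal B)) :
    G.linearGraph.tgt e = none ∧
      G.linearGraph.left e = FreeMonoid.ofList (G.fill e.1.1.output) ∧
      G.linearGraph.right e = 1 := by
  rcases hx : e.1.1.output[e.1.2]? with _ | (a | B)
  · simp [linearGraph, hx]
  · simp [linearGraph, hx]
  · exact absurd hx (h B)

theorem vertexYields_edge (e : G.linearEdges) {w : FreeMonoid α}
    (h : G.VertexYields (G.linearGraph.tgt e) w.toList) :
    G.VertexYields (G.linearGraph.src e)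
      (G.linearGraph.left e * w * G.linearGraph.right e).toList := by
  obtain ⟨⟨hr, -⟩, v, hv⟩ := G.mem_linearEdges.1 e.2
  refine Yields.of_rule hr ?_
  by_cases hx : ∃ B, e.1.1.output[e.1.2]? = some (Symbol.nonterminal B)
  · obtain ⟨B, hB⟩ := hx
    obtain ⟨ht, hl, hr⟩ := linearGraph_of_nonterminal hB
    have hsplit : e.1.1.output = e.1.1.output.take e.1.2 ++
        ([Symbol.nonterminal B] ++ e.1.1.output.drop (e.1.2 + 1)) := by
      obtain ⟨_, hB'⟩ := List.getElem?_eq_some_iff.1 hB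
      rw [List.singleton_append, ← hB', List.getElem_cons_drop, List.take_append_drop]
    rw [ht] at h
    rw [hl, hr]
    rw [hsplit] at hv
    obtain ⟨_, _, h₁, h₂, -⟩ := hv.exists_of_append
    obtain ⟨_, _, -, h₃, -⟩ := h₂.exists_of_append
    have := h₁.fill.append (Yields.append h h₃.fill)
    rw [← hsplit] at this
    simpa using this
  · obtain ⟨ht, hl, hr⟩ := linearGraph_of_not_nonterminal (not_exists.1 hx)
    rw [ht] at h
    have hw : w = 1 := h
    simpa [hl, hr, hw] using hv.fill

theorem vertexYields_path {q : Option G.NT} {p : List G.linearEdges}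
    (h : G.linearGraph.IsPath q p none) : G.VertexYields q (G.linearGraph.word p).toList := by
  induction p generalizing q with
  | nil =>
    obtain rfl : q = none := h
    rfl
  | cons e p ih =>
    obtain ⟨rfl, hp⟩ := h
    have := vertexYields_edge e (ih hp)
    rw [← List.singleton_append, PairGraph.word_append]
    simpa [PairGraph.leftProd, PairGraph.rightProd] using this

theorem agree_exchange {M H : Type*} [Monoid M] [Group H] (φ ψ : M →* H) {x a b c d y : M}
    (h₁ : φ (x * (a * d) * y) = ψ (x * (a * d) * y))
    (h₂ : φ (x * (c * b) * y) = ψ (x * (c * b) * y))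
    (h₃ : φ (x * (c * d) * y) = ψ (x * (c * d) * y)) :
    φ (x * (a * b) * y) = ψ (x * (a * b) * y) := by
  have key : ∀ θ : M →* H, θ (x * (a * b) * y) =
      θ (x * (a * d) * y) * (θ (x * (c * d) * y))⁻¹ * θ (x * (c * b) * y) := fun θ => by
    simp only [map_mul]
    group
  rw [key, key, h₁, h₂, h₃]

/-- If two morphisms into a group agree on the words of `G.linearGraph`, then they agree on `G`.
The word `x * w₁ * w₂ * y` is handled through the three words in which `w₁` or `w₂` or both are
replaced by chosen words. -/
theorem agree_of_agree_linearGraph {H : Type*} [Group H] (φ ψ : FreeMonoid α →* H)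
    {S : Option G.NT}
    (hlin : ∀ p, G.linearGraph.IsPath S p none →
      φ (G.linearGraph.word p) = ψ (G.linearGraph.word p))
    {s : List (Symbol α G.NT)} {w : List α} (hw : G.Yields s w)
    {r : ContextFreeRule α G.NT} (hr : r ∈ G.rules) {v : List α} (hv : G.Yields r.output v)
    {s₀ : List (Symbol α G.NT)} (hs₀ : r.output = s₀ ++ s) {p : List G.linearEdges}
    (hp : G.linearGraph.IsPath S p (some r.input)) :
    φ (G.linearGraph.leftProd p * FreeMonoid.ofList (G.fill s₀ ++ w) * G.linearGraph.rightProd p) =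
      ψ (G.linearGraph.leftProd p * FreeMonoid.ofList (G.fill s₀ ++ w) *
        G.linearGraph.rightProd p) := by
  have edge_mem : ∀ {r : ContextFreeRule α G.NT} {v : List α}, r ∈ G.rules →
      G.Yields r.output v → ∀ i, i ≤ r.output.length →
        (⟨r, i⟩ : Σ _ : ContextFreeRule α G.NT, ℕ) ∈ G.linearEdges :=
    fun hr hv i hi => G.mem_linearEdges.2 ⟨⟨hr, hi⟩, _, hv⟩
  have full : ∀ {r : ContextFreeRule α G.NT} {v : List α} {p : List G.linearEdges},
      r ∈ G.rules → G.Yields r.output v → G.linearGraph.IsPath S p (some r.input) →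
      φ (G.linearGraph.leftProd p * FreeMonoid.ofList (G.fill r.output) *
        G.linearGraph.rightProd p) = ψ (G.linearGraph.leftProd p *
          FreeMonoid.ofList (G.fill r.output) * G.linearGraph.rightProd p) := by
    intro r v p hr hv hp
    obtain ⟨ht, hl, hr'⟩ := linearGraph_of_not_nonterminal
      (e := ⟨⟨r, r.output.length⟩, edge_mem hr hv _ le_rfl⟩) (by simp)
    have hlast : G.linearGraph.IsPath (some r.input)
        [⟨⟨r, r.output.length⟩, edge_mem hr hv _ le_rfl⟩] none :=
      (PairGraph.isPath_singleton _).2 ht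
    have := hlin _ (hp.append hlast)
    simpa [PairGraph.word_append, PairGraph.word, PairGraph.leftProd, PairGraph.rightProd,
      hl, hr'] using this
  induction hw generalizing r v s₀ p with
  | nil => simpa [hs₀, fill_append, fill] using full hr hv hp
  | terminal a _ ih =>
    have := ih hr hv (s₀ := s₀ ++ [Symbol.terminal a]) (by simpa using hs₀) hp
    simpa [fill_append, fill] using this
  | @nonterminal r₁ hr₁ s w₁ w₂ h₁ h₂ ih₁ ih₂ =>
    have hlen : s₀.length < r.output.length := by simp [hs₀]
    have e₂ := ih₂ hr hv (s₀ := s₀ ++ [Symbol.nonterminal r₁.input]) (by simpa using hs₀) hp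
    have e₃ := full hr hv hp
    obtain ⟨ht, hl, hr'⟩ := linearGraph_of_nonterminal (B := r₁.input)
      (e := ⟨⟨r, s₀.length⟩, edge_mem hr hv _ hlen.le⟩) (by simp [hs₀])
    have hstep : G.linearGraph.IsPath (some r.input)
        [⟨⟨r, s₀.length⟩, edge_mem hr hv _ hlen.le⟩] (some r₁.input) :=
      (PairGraph.isPath_singleton _).2 ht
    have e₁ := ih₁ hr₁ h₁ (s₀ := []) rfl (hp.append hstep)
    have hdrop : r.output.drop (s₀.length + 1) = s := by simp [hs₀, ← List.drop_drop]
    have htake : r.output.take s₀.length = s₀ := by simp [hs₀]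
    simp only [PairGraph.leftProd_append, PairGraph.rightProd_append] at e₁
    simp only [PairGraph.leftProd, PairGraph.rightProd, List.map_cons, List.map_nil,
      List.reverse_singleton, List.prod_singleton, hl, hr', hdrop, htake] at e₁
    have := agree_exchange φ ψ (x := G.linearGraph.leftProd p * FreeMonoid.ofList (G.fill s₀))
      (a := FreeMonoid.ofList w₁) (b := FreeMonoid.ofList w₂)
      (c := FreeMonoid.ofList (G.fillNonterminal r₁.input)) (d := FreeMonoid.ofList (G.fill s))
      (y := G.linearGraph.rightProd p)
      (by simpa [fill, mul_assoc, PairGraph.leftProd, PairGraph.rightProd] using e₁)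
      (by simpa [fill, fill_append, mul_assoc] using e₂)
      (by simpa [hs₀, fill, fill_append, mul_assoc] using e₃)
    simpa [mul_assoc] using this

theorem language_subset_of_size_le_one (hG : G.size ≤ 1) {w : List α} (hw : w ∈ G.language) :
    w = [] := by
  have hout : ∀ r ∈ G.rules, r.output = [] := fun r hr => by
    have := Finset.single_le_sum (f := fun r : ContextFreeRule α G.NT => r.output.length + 1)
      (fun _ _ => Nat.zero_le _) hr
    rw [← List.length_eq_zero_iff]
    unfold ContextFreeGrammar.size at hG
    omega
  obtain ⟨r, hr, -, h⟩ := (mem_language_iff_yields.1 hw).exists_rule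
  rw [hout r hr] at h
  cases h
  rfl

end ContextFreeGrammar

/-! ### The test set of a context-free grammar -/

theorem mainTheorem2 {α : Type u} (G : ContextFreeGrammar α) :
    ∃ T : Finset (List α),
      IsTestSet.{u, v} (T : Set (List α)) G.language ∧ T.card ≤ 2 * G.size ^ 3 := by
  classical
  rcases Nat.lt_or_ge 1 G.size with hG | hG
  · obtain ⟨T, hcard, hsound, htest⟩ :=
      PairGraph.exists_testSet.{v, _, _, _} G.linearGraph (some G.initial) none
    refine ⟨T.image FreeMonoid.toList, ⟨?_, ?_⟩, ?_⟩
    · intro w hw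
      obtain ⟨x, hx, rfl⟩ := Finset.mem_image.1 (Finset.mem_coe.1 hw)
      obtain ⟨p, hp, rfl⟩ := hsound x hx
      exact ContextFreeGrammar.mem_language_iff_yields.2
        (ContextFreeGrammar.vertexYields_path hp)
    · intro Γ f g hT w hw
      apply FreeMonoid.lift_of_injective Γ
      have hlin := htest (FreeGroup Γ) (fun c d e => FreeGroup.commute_trans)
        ((FreeMonoid.lift FreeGroup.of).comp f) ((FreeMonoid.lift FreeGroup.of).comp g)
        fun x hx => congrArg (FreeMonoid.lift FreeGroup.of)
          (hT x.toList (Finset.mem_coe.2 (Finset.mem_image_of_mem FreeMonoid.toList hx)))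
      obtain ⟨r, hr, hA, h⟩ :=
        (ContextFreeGrammar.mem_language_iff_yields.1 hw).exists_rule
      have := ContextFreeGrammar.agree_of_agree_linearGraph _ _ hlin h hr h (s₀ := [])
        rfl (p := []) (congrArg some hA.symm)
      simpa [ContextFreeGrammar.fill, PairGraph.leftProd, PairGraph.rightProd] using this
    · refine Finset.card_image_le.trans (hcard.trans ?_)
      have hm := G.card_linearEdges_le
      calc ∑ i ∈ Finset.range 4, Fintype.card G.linearEdges ^ i
          ≤ ∑ i ∈ Finset.range 4, G.size ^ i :=
            Finset.sum_le_sum fun i _ => Nat.pow_le_pow_left hm i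
        _ ≤ 2 * G.size ^ 3 := by
            obtain ⟨n, hn⟩ := Nat.exists_eq_add_of_lt hG
            simp only [Finset.sum_range_succ, Finset.sum_range_zero, hn]
            ring_nf
            nlinarith [Nat.zero_le n, Nat.zero_le (n ^ 2), Nat.zero_le (n ^ 3)]
  · have hsub : ((∅ : Finset (List α)) : Set (List α)) ⊆ G.language := by
      rw [Finset.coe_empty]
      exact Set.empty_subset _
    refine ⟨∅, ⟨hsub, fun Γ f g _ w hw => ?_⟩, by simp⟩
    obtain rfl := ContextFreeGrammar.language_subset_of_size_le_one hG hw
    exact (map_one f).trans (map_one g).symm
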